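/- Setting. Let $m,n\ge 1$, $\Omega\subset\{1,\dots,m\}\times\{1,\dots,n\}$, $Y\in\mathbb R^{m\times n}$ and $\ell\ge 0$. Let $P_\Omega(A)$ be the matrix that agrees with $A$ on $\Omega$ and is zero elsewhere, and $P_\Omega^\perp(A)=A-P_\Omega(A)$. Let $\sigma_1(A)\ge\sigma_2(A)\ge\cdots$ be the singular values of $A$, with $\sigma_i(A)=0$ for $i>\min\{m,n\}$. Let $P:[0,\infty)\to\mathbb R$ be a penalty that is concave on $[0,\infty)$, differentiable on $(0,\infty)$ and bounded below; if $\ell=0$, assume also that $P$ is continuous at $0$. Put $$\phi_P=\inf_{\alpha,\alpha'>0,\ \alpha\ne\alpha'}\frac{P'(\alpha)-P'(\alpha')}{\alpha-\alpha'}\in[-\infty,\infty),\qquad \nu(\ell)=1+\phi_P+\ell,\qquad \nu^\dagger(\ell)=\max\{\nu(\ell),0\}.$$ Let $(X_k)_{k}$ be any sequence of $m\times n$ real matrices such that, for every $k$, $X_{k+1}\in\arg\min_X F_\ell(X;X_k)$, where $$F_\ell(X;X_k)=\tfrac12\|P_\Omega(X-Y)\|_F^2+\tfrac12\|P_\Omega^\perp(X-X_k)\|_F^2+\tfrac{\ell}{2}\|X-X_k\|_F^2+\sum_{i=1}^{\min\{m,n\}}P(\sigma_i(X)).$$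 Distance. Let $S_1,S_2\in\mathbb R^{d\times p}$ have orthonormal columns and let $S_1^\perp$ be such that $[S_1,S_1^\perp]$ is an orthogonal $d\times d$ matrix. The canonical angles $\Theta(S_1,S_2)$ are the numbers $\arcsin\sigma_i((S_1^\perp)'S_2)$, $1\le i\le p$, and $\|\sin\Theta(S_1,S_2)\|_2$ is the spectral norm of the diagonal matrix of their sines, i.e. the largest sine. For $A,\widetilde A\in\mathbb R^{m\times n}$ and $1\le p\le\min\{m,n\}$, let $U_1,V_1$ (respectively $\widetilde U_1,\widetilde V_1$) be matrices of left and right singular vectors for the $p$ largest singular values of $A$ (respectively $\widetilde A$), and let $$\rho_p(A,\widetilde A)=\max\{\|\sin\Theta(U_1,\widetilde U_1)\|_2,\ \|\sin\Theta(V_1,\widetilde V_1)\|_2\}.$$ Proposition. Suppose $\nu^\dagger(\ell)+\ell>0$ and, for some $1\le p\le\min\{m,n\}$, let $\delta_{k,p}=\sigma_{p+1}(X_k)-\sigma_p(X_{k+1})$. If $\liminf_{k\to\infty}|\delta_{k,p}|>0$ (the liminf may be $+\infty$), then $\rho_p(X_k,X_{k+1})\to0$ as $k\to\infty$, for every choice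 of the singular vectors (and orthonormal completions) used to compute $\rho_p(X_k,X_{k+1})$. -/

import Mathlib

open Filter Topology

namespace NCImpute

noncomputable section

/-- The `i`-th largest singular value of `A`, with the index `i ≥ 1` counted from one;
it is zero for `i > min m n`. -/
def sigma {m n : ℕ} (i : ℕ) (A : Matrix (Fin m) (Fin n) ℝ) : ℝ :=
  (Matrix.toEuclideanLin A).singularValues (i - 1)

/-- The spectral norm (largest singular value) of a square matrix, as an operator norm. -/
def spectralNorm {p : ℕ} (A : Matrix (Fin p) (Fin p) ℝ) : ℝ :=
  ‖Matrix.toEuclideanCLM (n := Fin p) (𝕜 := ℝ) A‖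

/-- The square of the Frobenius norm. -/
def frobSq {m n : ℕ} (A : Matrix (Fin m) (Fin n) ℝ) : ℝ :=
  ∑ i, ∑ j, A i j ^ 2

/-- `P_Ω`: keep the entries indexed by `Ω`, and set the others to zero. -/
def proj {m n : ℕ} (Ω : Finset (Fin m × Fin n)) (A : Matrix (Fin m) (Fin n) ℝ) :
    Matrix (Fin m) (Fin n) ℝ :=
  Matrix.of fun i j => if (i, j) ∈ Ω then A i j else 0

/-- `P_Ω^⊥ = id - P_Ω`. -/
def projPerp {m n : ℕ} (Ω : Finset (Fin m × Fin n)) (A : Matrix (Fin m) (Fin n) ℝ) :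
    Matrix (Fin m) (Fin n) ℝ :=
  A - proj Ω A

/-- The spectral penalty `∑_{i ≤ min(m,n)} P(σ_i(X))`. -/
def spectralPenalty {m n : ℕ} (P : ℝ → ℝ) (X : Matrix (Fin m) (Fin n) ℝ) : ℝ :=
  ∑ i ∈ Finset.Icc 1 (min m n), P (sigma i X)

/-- The majorizing objective `F_ℓ(X; W)`. -/
def majorizer {m n : ℕ} (Ω : Finset (Fin m × Fin n)) (Y : Matrix (Fin m) (Fin n) ℝ)
    (P : ℝ → ℝ) (l : ℝ) (W X : Matrix (Fin m) (Fin n) ℝ) : ℝ :=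
  1 / 2 * frobSq (proj Ω (X - Y)) + 1 / 2 * frobSq (projPerp Ω (X - W))
    + l / 2 * frobSq (X - W) + spectralPenalty P X

/-- The concavity measure `φ_P`: the infimum over distinct `α, α' > 0` of
`(P'(α) - P'(α')) / (α - α')`, an extended real number (it may be `-∞`). -/
def phi (P : ℝ → ℝ) : EReal :=
  ⨅ q : {q : ℝ × ℝ // 0 < q.1 ∧ 0 < q.2 ∧ q.1 ≠ q.2},
    (((deriv P q.1.1 - deriv P q.1.2) / (q.1.1 - q.1.2) : ℝ) : EReal)

/-- `ν(ℓ) = 1 + φ_P + ℓ`. -/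
def nu (P : ℝ → ℝ) (l : ℝ) : EReal := 1 + phi P + (l : EReal)

/-- `ν†(ℓ) = max {ν(ℓ), 0}`. -/
def nuDagger (P : ℝ → ℝ) (l : ℝ) : EReal := max (nu P l) 0

/-- The columns of `[S, T]` form an orthonormal basis of `ℝ^m`. -/
def IsOrthonormalCompletion {m p : ℕ} (S : Matrix (Fin m) (Fin p) ℝ)
    (T : Matrix (Fin m) (Fin (m - p)) ℝ) : Prop :=
  (Matrix.fromCols S T).transpose * Matrix.fromCols S T = 1 ∧
    Matrix.fromCols S T * (Matrix.fromCols S T).transpose = 1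

/-- The canonical angles between the column spaces of two matrices with `p` orthonormal columns.
The first one enters through the orthonormal complement `T` of its columns: the angles are the
arcsines of the `p` largest singular values of `T' S₂`. -/
def canonicalAngles {m p q : ℕ} (T : Matrix (Fin m) (Fin q) ℝ)
    (S₂ : Matrix (Fin m) (Fin p) ℝ) : Fin p → ℝ :=
  fun i => Real.arcsin (sigma (i.1 + 1) (T.transpose * S₂))

/-- `‖sin Θ‖₂`, the spectral norm of the diagonal matrix of the sines of the canonical angles. -/
def sinThetaNorm {m p q : ℕ} (T : Matrix (Fin m) (Fin q) ℝ)
    (S₂ : Matrix (Fin m) (Fin p) ℝ) : ℝ :=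
  spectralNorm (Matrix.diagonal fun i => Real.sin (canonicalAngles T S₂ i))

/-- A choice of left and right singular vectors of `A` for its `p` largest singular values,
`A V = U Σ` and `A' U = V Σ` with `Σ = diag(σ_1(A), …, σ_p(A))`, together with orthonormal
completions of `U` and `V`. -/
structure TopSingularFrame {m n : ℕ} (p : ℕ) (A : Matrix (Fin m) (Fin n) ℝ) where
  U : Matrix (Fin m) (Fin p) ℝ
  V : Matrix (Fin n) (Fin p) ℝ
  Uperp : Matrix (Fin m) (Fin (m - p)) ℝ
  Vperp : Matrix (Fin n) (Fin (n - p)) ℝ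
  orthU : IsOrthonormalCompletion U Uperp
  orthV : IsOrthonormalCompletion V Vperp
  mul_V : A * V = U * Matrix.diagonal fun i : Fin p => sigma (i.1 + 1) A
  transpose_mul_U : A.transpose * U = V * Matrix.diagonal fun i : Fin p => sigma (i.1 + 1) A

/-- The distance `ρ_p(A, B)` between the top-`p` left and right singular subspaces, computed from
given choices of singular vectors of `A` and `B`. -/
def rho {m n p : ℕ} {A B : Matrix (Fin m) (Fin n) ℝ}
    (a : TopSingularFrame p A) (b : TopSingularFrame p B) : ℝ :=
  max (sinThetaNorm a.Uperp b.U) (sinThetaNorm a.Vperp b.V)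

/-- `δ_{k,p} = σ_{p+1}(X_k) - σ_p(X_{k+1})`. -/
def delta {m n : ℕ} (X : ℕ → Matrix (Fin m) (Fin n) ℝ) (p k : ℕ) : ℝ :=
  sigma (p + 1) (X k) - sigma p (X (k + 1))

end

end NCImpute

/-! The steps X_{k+1} - X_k tend to zero in Frobenius norm, and a Wedin-type sin Θ bound converts
small steps plus a spectral gap into small rotation of the singular subspaces.

Small steps come from sufficient decrease of the objective ½‖P_Ω(X - Y)‖² + ∑ P(σ_i(X))
(`exists_sufficient_decrease`). If ℓ > 0, the proximal term yields the decrease directly. If ℓ = 0,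
the hypothesis says φ_P > -1, so P(t) + c t²/2 is convex for some c in [0, 1). It is also
nondecreasing, because a concave function bounded below is. Such functions of the singular values
are midpoint convex in the matrix (`sum_singularValues_midpoint_le`), so the majorizer is strongly
midpoint convex, with modulus 1 - c. The objective is bounded below, hence the squared steps vanish
(`tendsto_frobSq_step`).

By Weyl's inequality, σ_{p+1}(X_k) cannot exceed σ_p(X_{k+1}) by more than the step. So |δ_{k,p}| >
g eventually forces σ_p(X_{k+1}) > σ_{p+1}(X_k) + g, and `rho_le` bounds ρ_p by √p ‖X_{k+1} - X_k‖_F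
/ g for any choice of frames. -/

namespace NCImpute

/-! ### Singular value decomposition and the Courant-Fischer lower bound -/

section SingularValues

variable {E F : Type*} [NormedAddCommGroup E] [InnerProductSpace ℝ E] [FiniteDimensional ℝ E]
  [NormedAddCommGroup F] [InnerProductSpace ℝ F] [FiniteDimensional ℝ F]

open Module

/-- Right singular vectors form an orthonormal basis, whose image is orthogonal with norms the
singular values. -/
theorem exists_rightSingularBasis (T : E →ₗ[ℝ] F) {n : ℕ} (hn : finrank ℝ E = n) :
    ∃ v : OrthonormalBasis (Fin n) ℝ E, ∀ i j,
      inner ℝ (T (v i)) (T (v j)) = if i = j then T.singularValues i ^ 2 else 0 := by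
  refine ⟨T.isSymmetric_adjoint_comp_self.eigenvectorBasis hn, fun i j => ?_⟩
  rw [← LinearMap.adjoint_inner_right, ← LinearMap.comp_apply,
    T.isSymmetric_adjoint_comp_self.apply_eigenvectorBasis hn j, inner_smul_right,
    OrthonormalBasis.inner_eq_ite]
  split_ifs with h
  · subst h
    simp [T.sq_singularValues_fin hn]
  · simp

/-- A singular value decomposition of `T`; the left singular vectors of the zero singular values
are zero. -/
theorem exists_singularValueDecomposition (T : E →ₗ[ℝ] F) {n : ℕ} (hn : finrank ℝ E = n) :
    ∃ (v : OrthonormalBasis (Fin n) ℝ E) (u : Fin n → F),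
      (∀ i, T (v i) = T.singularValues i • u i) ∧
      (∀ i, inner ℝ (u i) (T (v i)) = T.singularValues i) ∧ (∀ i, ‖u i‖ ≤ 1) ∧
      ∀ y, ∑ i, inner ℝ (u i) y ^ 2 ≤ ‖y‖ ^ 2 := by
  obtain ⟨v, hv⟩ := exists_rightSingularBasis T hn
  have hz : ∀ i : Fin n, T.singularValues i = 0 → T (v i) = 0 := fun i hi => by
    have := hv i i
    simpa [hi] using this
  -- Since `0⁻¹ = 0`, this vector is zero when the singular value is; the nonzero ones are
  -- orthonormal, and Bessel's inequality suffices below.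
  let u : Fin n → F := fun i => (T.singularValues i)⁻¹ • T (v i)
  have huu : ∀ i j, inner ℝ (u i) (u j) =
      if i = j ∧ T.singularValues i ≠ 0 then 1 else 0 := by
    intro i j
    simp only [u, inner_smul_left, inner_smul_right, hv]
    by_cases hij : i = j
    · subst hij
      by_cases h0 : T.singularValues i = 0
      · simp [h0]
      · simp [h0]
        field_simp
    · simp [hij]
  have hnorm : ∀ i, ‖u i‖ ^ 2 = if T.singularValues i ≠ 0 then 1 else 0 := fun i => by
    rw [← real_inner_self_eq_norm_sq, huu]
    simp
  refine ⟨v, u, fun i => ?_, fun i => ?_, fun i => ?_, fun y => ?_⟩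
  · by_cases h0 : T.singularValues i = 0
    · simp [h0, hz i h0]
    · simp [u, smul_smul, h0]
  · simp only [u, inner_smul_left, hv]
    by_cases h0 : T.singularValues i = 0
    · simp [h0]
    · simp
      field_simp
  · have := hnorm i
    split_ifs at this <;> nlinarith [norm_nonneg (u i)]
  · have ho : Orthonormal ℝ (fun i : {i : Fin n // T.singularValues i ≠ 0} => u i) := by
      rw [orthonormal_iff_ite]
      intro i j
      rw [huu]
      simp [i.2, Subtype.ext_iff]
    have hb := ho.sum_inner_products_le (s := Finset.univ) y
    simp only [Real.norm_eq_abs, sq_abs] at hb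
    refine le_trans (le_of_eq ?_) hb
    rw [← Finset.sum_subtype (Finset.univ.filter fun i : Fin n => T.singularValues i ≠ 0)
      (by simp) (fun i => inner ℝ (u i) y ^ 2), Finset.sum_filter_of_ne]
    intro i _ hi h0
    simp [u, h0] at hi

theorem norm_map_sq_of_rightSingularBasis (T : E →ₗ[ℝ] F) {n : ℕ}
    (v : OrthonormalBasis (Fin n) ℝ E)
    (hv : ∀ i j, inner ℝ (T (v i)) (T (v j)) = if i = j then T.singularValues i ^ 2 else 0)
    (x : E) : ‖T x‖ ^ 2 = ∑ i : Fin n, T.singularValues i ^ 2 * inner ℝ (v i) x ^ 2 := by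
  rw [← real_inner_self_eq_norm_sq]
  conv_lhs => rw [← v.sum_repr' x]
  simp only [map_sum, map_smul, sum_inner, inner_sum, inner_smul_left, inner_smul_right, hv]
  refine Finset.sum_congr rfl fun i _ => ?_
  simp
  ring

theorem singularValues_le_of_norm_map_le (T : E →ₗ[ℝ] F) {c : ℝ} (hc : 0 ≤ c)
    (h : ∀ x, ‖T x‖ ≤ c * ‖x‖) (i : ℕ) : T.singularValues i ≤ c := by
  by_cases hi : finrank ℝ E ≤ i
  · rwa [T.singularValues_of_finrank_le hi]
  · obtain ⟨v, hv⟩ := exists_rightSingularBasis T rfl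
    have h1 := hv ⟨i, not_le.1 hi⟩ ⟨i, not_le.1 hi⟩
    have h2 := h (v ⟨i, not_le.1 hi⟩)
    rw [real_inner_self_eq_norm_sq] at h1
    simp only [if_true] at h1
    simp only [OrthonormalBasis.norm_eq_one, mul_one] at h2
    rw [sq_eq_sq₀ (norm_nonneg _) (T.singularValues_nonneg i)] at h1
    exact h1 ▸ h2

/-- The Courant-Fischer lower bound for a singular value. -/
theorem le_singularValues_of_le_norm_map (T : E →ₗ[ℝ] F) {j : ℕ} {s : ℝ}
    {w : Fin (j + 1) → E} (hw : LinearIndependent ℝ w)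
    (h : ∀ c : Fin (j + 1) → ℝ, s * ‖∑ k, c k • w k‖ ≤ ‖T (∑ k, c k • w k)‖) :
    s ≤ T.singularValues j := by
  obtain ⟨v, hv⟩ := exists_rightSingularBasis T rfl
  have hj : j < finrank ℝ E := by
    have := hw.fintype_card_le_finrank
    simp at this
    omega
  -- Dimension count: some nonzero combination of the j + 1 vectors is orthogonal to the first j
  -- right singular vectors, and there T stretches by at most its singular value of index j.
  let L : (Fin (j + 1) → ℝ) →ₗ[ℝ] (Fin j → ℝ) :=
    LinearMap.pi (fun i : Fin j => (innerₛₗ ℝ (v ⟨i, i.2.trans hj⟩)) ∘ₗ (Fintype.linearCombination ℝ w))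
  have hker : LinearMap.ker L ≠ ⊥ := L.ker_ne_bot_of_finrank_lt (by simp)
  obtain ⟨c, hc, hc0⟩ := (Submodule.ne_bot_iff _).1 hker
  set x := ∑ k, c k • w k with hx
  have hx0 : x ≠ 0 := fun h0 => hc0 (funext (Fintype.linearIndependent_iff.1 hw c h0))
  have horth : ∀ i : Fin (finrank ℝ E), i.1 < j → inner ℝ (v i) x = 0 := fun i hi => by
    have := congrFun (LinearMap.mem_ker.1 hc) ⟨i, hi⟩
    simpa [L, Fintype.linearCombination_apply] using this
  have hT : ‖T x‖ ^ 2 ≤ T.singularValues j ^ 2 * ‖x‖ ^ 2 := by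
    rw [norm_map_sq_of_rightSingularBasis T v hv, ← v.sum_sq_inner_right x, Finset.mul_sum]
    refine Finset.sum_le_sum fun i _ => ?_
    by_cases hi : i.1 < j
    · simp [horth i hi]
    · gcongr
      · exact T.singularValues_nonneg _
      · exact T.singularValues_antitone (not_lt.1 hi)
  have hT' : ‖T x‖ ≤ T.singularValues j * ‖x‖ :=
    (sq_le_sq₀ (norm_nonneg _) (mul_nonneg (T.singularValues_nonneg _) (norm_nonneg _))).1
      (by rwa [mul_pow])
  exact le_of_mul_le_mul_right ((h c).trans hT') (norm_pos_iff.2 hx0)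

end SingularValues

/-! ### Convexity of spectral functions -/

section SpectralConvexity

variable {E F : Type*} [NormedAddCommGroup E] [InnerProductSpace ℝ E] [FiniteDimensional ℝ E]
  [NormedAddCommGroup F] [InnerProductSpace ℝ F] [FiniteDimensional ℝ F]

open Module

/-- Jensen's inequality with substochastic weights, for a convex function vanishing at zero. -/
theorem convexOn_sum_mul_le_of_sum_le_one {Q : ℝ → ℝ} (hQ : ConvexOn ℝ (Set.Ici 0) Q)
    (h0 : Q 0 = 0) {ι : Type*} [Fintype ι] {w s : ι → ℝ} (hw : ∀ i, 0 ≤ w i)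
    (hw1 : ∑ i, w i ≤ 1) (hs : ∀ i, 0 ≤ s i) :
    Q (∑ i, w i * s i) ≤ ∑ i, w i * Q (s i) := by
  -- The missing mass is placed at 0, where Q vanishes.
  have := hQ.map_sum_le (t := Finset.univ) (w := fun i : Option ι => i.elim (1 - ∑ i, w i) w)
    (p := fun i : Option ι => i.elim 0 s)
    (by rintro (_ | i) -; exacts [sub_nonneg.2 hw1, hw i])
    (by simp [Fintype.sum_option])
    (by rintro (_ | i) -; exacts [Set.mem_Ici.2 le_rfl, hs i])
  simpa [Fintype.sum_option, h0] using this

/-- A Peierls-type inequality for singular values. -/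
theorem sum_abs_inner_map_le (T : E →ₗ[ℝ] F) {n : ℕ} (hn : finrank ℝ E = n)
    {Q : ℝ → ℝ} (hQ : ConvexOn ℝ (Set.Ici 0) Q) (hmono : MonotoneOn Q (Set.Ici 0))
    (h0 : Q 0 = 0) (v : OrthonormalBasis (Fin n) ℝ E) {u : Fin n → F} (hu1 : ∀ i, ‖u i‖ ≤ 1)
    (hu : ∀ y, ∑ i, inner ℝ (u i) y ^ 2 ≤ ‖y‖ ^ 2) :
    ∑ i, Q |inner ℝ (u i) (T (v i))| ≤ ∑ i : Fin n, Q (T.singularValues i) := by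
  obtain ⟨b, a, hTb, -, ha1, ha⟩ := exists_singularValueDecomposition T hn
  have hQ0 : ∀ x, 0 ≤ x → 0 ≤ Q x := fun x hx =>
    h0 ▸ hmono (Set.mem_Ici.2 le_rfl) (Set.mem_Ici.2 hx) hx
  -- By AM-GM these weights dominate the products of overlaps with the singular vectors of T. Bessel
  -- and Parseval make them doubly substochastic, so Jensen applies along rows and column sums are
  -- at most 1.
  let w : Fin n → Fin n → ℝ := fun i j =>
    (inner ℝ (a j) (u i) ^ 2 + inner ℝ (b j) (v i) ^ 2) / 2
  have hw0 : ∀ i j, 0 ≤ w i j := fun i j => by positivity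
  have hrow : ∀ i, ∑ j, w i j ≤ 1 := fun i => by
    rw [← Finset.sum_div, Finset.sum_add_distrib, b.sum_sq_inner_right, v.norm_eq_one]
    nlinarith [ha (u i), hu1 i, norm_nonneg (u i)]
  have hcol : ∀ j, ∑ i, w i j ≤ 1 := fun j => by
    rw [← Finset.sum_div, Finset.sum_add_distrib, v.sum_sq_inner_left, b.norm_eq_one]
    have := hu (a j)
    simp only [real_inner_comm (a j)] at this
    nlinarith [ha1 j, norm_nonneg (a j)]
  have hentry : ∀ i, |inner ℝ (u i) (T (v i))| ≤ ∑ j, w i j * T.singularValues j := fun i => by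
    conv_lhs => rw [← b.sum_repr' (v i)]
    simp only [map_sum, map_smul, inner_sum, inner_smul_right, hTb]
    refine (Finset.abs_sum_le_sum_abs _ _).trans (Finset.sum_le_sum fun j _ => ?_)
    have hs := T.singularValues_nonneg j
    rw [abs_mul, abs_mul, abs_of_nonneg hs, real_inner_comm (a j) (u i)]
    have := two_mul_le_add_sq |inner ℝ (a j) (u i)| |inner ℝ (b j) (v i)|
    rw [sq_abs, sq_abs] at this
    calc _ = |inner ℝ (a j) (u i)| * |inner ℝ (b j) (v i)| * T.singularValues j := by ring
      _ ≤ _ := by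
        refine mul_le_mul_of_nonneg_right ?_ hs
        simp only [w]
        linarith
  calc ∑ i, Q |inner ℝ (u i) (T (v i))|
      ≤ ∑ i, ∑ j, w i j * Q (T.singularValues j) := Finset.sum_le_sum fun i _ =>
        (hmono (Set.mem_Ici.2 (abs_nonneg _)) (Set.mem_Ici.2 <| (abs_nonneg _).trans (hentry i)) (hentry i)).trans
          (convexOn_sum_mul_le_of_sum_le_one hQ h0 (hw0 i) (hrow i)
            fun j => T.singularValues_nonneg j)
    _ = ∑ j, (∑ i, w i j) * Q (T.singularValues j) := by
        rw [Finset.sum_comm]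
        simp only [Finset.sum_mul]
    _ ≤ ∑ j : Fin n, Q (T.singularValues j) := Finset.sum_le_sum fun j _ =>
        mul_le_of_le_one_left (hQ0 _ (T.singularValues_nonneg j)) (hcol j)

/-- Midpoint convexity of a spectral function. -/
theorem sum_singularValues_midpoint_le (S T : E →ₗ[ℝ] F) {n : ℕ} (hn : finrank ℝ E = n)
    {Q : ℝ → ℝ} (hQ : ConvexOn ℝ (Set.Ici 0) Q) (hmono : MonotoneOn Q (Set.Ici 0))
    (h0 : Q 0 = 0) :
    ∑ i : Fin n, Q (((1 / 2 : ℝ) • (S + T)).singularValues i) ≤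
      1 / 2 * ∑ i : Fin n, Q (S.singularValues i) +
        1 / 2 * ∑ i : Fin n, Q (T.singularValues i) := by
  -- S and T are both tested on the singular vectors of their midpoint, where its singular values
  -- are averages of the two diagonals.
  obtain ⟨v, u, -, hM, hu1, hu⟩ :=
    exists_singularValueDecomposition ((1 / 2 : ℝ) • (S + T)) hn
  refine le_trans ?_ (add_le_add
    (mul_le_mul_of_nonneg_left (sum_abs_inner_map_le S hn hQ hmono h0 v hu1 hu) (by norm_num))
    (mul_le_mul_of_nonneg_left (sum_abs_inner_map_le T hn hQ hmono h0 v hu1 hu) (by norm_num)))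
  rw [Finset.mul_sum, Finset.mul_sum, ← Finset.sum_add_distrib]
  refine Finset.sum_le_sum fun i _ => ?_
  have hconv := hQ.2 (Set.mem_Ici.2 (abs_nonneg (inner ℝ (u i) (S (v i)))))
    (Set.mem_Ici.2 (abs_nonneg (inner ℝ (u i) (T (v i)))))
    (by norm_num : (0 : ℝ) ≤ 1 / 2) (by norm_num : (0 : ℝ) ≤ 1 / 2) (by norm_num)
  simp only [smul_eq_mul] at hconv
  refine le_trans (hmono (LinearMap.singularValues_nonneg _ _) ?_ ?_) hconv
  · exact Set.mem_Ici.2 (by positivity)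
  · rw [← hM i, LinearMap.smul_apply, LinearMap.add_apply, inner_smul_right, inner_add_right]
    linarith [le_abs_self (inner ℝ (u i) (S (v i))), le_abs_self (inner ℝ (u i) (T (v i)))]

end SpectralConvexity

/-! ### The scalar penalty: monotonicity and weak convexity -/

section Penalty

theorem monotoneOn_of_concaveOn_of_bddBelow {P : ℝ → ℝ} (hP : ConcaveOn ℝ (Set.Ici 0) P)
    (hb : BddBelow (P '' Set.Ici 0)) : MonotoneOn P (Set.Ici 0) := by
  obtain ⟨B, hB⟩ := hb
  intro x hx y hy hxy
  rcases hxy.eq_or_lt with rfl | hlt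
  · rfl
  by_contra! hlt'
  have hx0 : (0 : ℝ) ≤ x := hx
  have hB' : ∀ z, 0 ≤ z → B ≤ P z := fun z hz => hB ⟨z, hz, rfl⟩
  -- a chord through `x` and `y` lies above `P` to the right of `y`
  set d := (P x - P y) / (y - x) with hd
  have hyx : 0 < y - x := sub_pos.2 hlt
  have hdpos : 0 < d := div_pos (sub_pos.2 hlt') hyx
  have hBy := hB' y hy
  -- The chord of slope -d reaches the height B - 1 at this point.
  set z := y + (P y - B + 1) / d with hz
  have hyz : y < z := by
    have : 0 < (P y - B + 1) / d := div_pos (by linarith) hdpos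
    linarith
  have hz0 : 0 ≤ z := hx0.trans (hlt.trans hyz).le
  have hs := hP.slope_anti_adjacent hx (Set.mem_Ici.2 hz0) hlt hyz
  rw [div_le_iff₀ (sub_pos.2 hyz)] at hs
  have h1 : (P y - P x) / (y - x) = -d := by rw [hd, ← neg_div]; ring
  have h2 : d * (z - y) = P y - B + 1 := by
    rw [hz]; field_simp; ring
  rw [h1] at hs
  linarith [hB' z hz0]

/-- Adding a quadratic compensating for the concavity measure makes the penalty convex. -/
theorem convexOn_add_sq {P : ℝ → ℝ}
    (hdiff : DifferentiableOn ℝ P (Set.Ioi 0)) (hcont : ContinuousWithinAt P (Set.Ici 0) 0)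
    {c : ℝ} (hc : ((-c : ℝ) : EReal) ≤ phi P) :
    ConvexOn ℝ (Set.Ici 0) fun t => P t + c / 2 * t ^ 2 := by
  have hdat : ∀ x, 0 < x → DifferentiableAt ℝ P x := fun x hx =>
    (hdiff x hx).differentiableAt (Ioi_mem_nhds hx)
  have hderiv : ∀ x, 0 < x → HasDerivAt (fun t => P t + c / 2 * t ^ 2) (deriv P x + c * x) x :=
    fun x hx => by
      have := (hdat x hx).hasDerivAt.add (((hasDerivAt_id x).pow 2).const_mul (c / 2))
      refine this.congr_deriv ?_
      simp
      ring
  refine MonotoneOn.convexOn_of_deriv (convex_Ici 0) ?_ ?_ ?_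
  · refine ContinuousOn.add (fun x hx => ?_) (by fun_prop)
    rcases (Set.mem_Ici.1 hx).eq_or_lt with rfl | hx
    · exact hcont
    · exact (hdat x hx).continuousAt.continuousWithinAt
  · rw [interior_Ici]
    exact fun x hx => (hderiv x hx).differentiableAt.differentiableWithinAt
  · rw [interior_Ici]
    intro x hx y hy hxy
    rw [(hderiv x hx).deriv, (hderiv y hy).deriv]
    rcases hxy.eq_or_lt with rfl | hlt
    · rfl
    have h1 := hc.trans (iInf_le _ ⟨(y, x), hy, hx, hlt.ne'⟩)
    rw [EReal.coe_le_coe_iff] at h1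
    simp only at h1
    rw [le_div_iff₀ (sub_pos.2 hlt)] at h1
    linarith

/-- With ℓ = 0 the hypothesis amounts to φ_P > -1. The bound c < 1 leaves strong convexity to spare,
and c ≥ 0 keeps the compensated penalty nondecreasing. -/
theorem exists_lt_one_neg_le_phi {P : ℝ → ℝ} (h : 0 < nuDagger P 0 + ((0 : ℝ) : EReal)) :
    ∃ c : ℝ, 0 ≤ c ∧ c < 1 ∧ ((-c : ℝ) : EReal) ≤ phi P := by
  have h1 : 0 < 1 + phi P := by
    simpa [nuDagger, nu] using h
  have h2 : ((-1 : ℝ) : EReal) < phi P := by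
    by_contra! hle
    have := add_le_add_right hle (1 : EReal)
    refine absurd (h1.trans_le this) ?_
    rw [← EReal.coe_one, ← EReal.coe_add]
    simp
  obtain ⟨r, hr1, hr2⟩ := EReal.lt_iff_exists_real_btwn.1 h2
  refine ⟨max (-r) 0, le_max_right _ _, max_lt ?_ one_pos, le_trans ?_ hr2.le⟩
  · have := EReal.coe_lt_coe_iff.1 hr1
    linarith
  · exact EReal.coe_le_coe_iff.2 (by linarith [le_max_left (-r) 0])

end Penalty

/-! ### Sufficient decrease and vanishing steps -/

section Descent

variable {m n : ℕ}

theorem frobSq_nonneg (A : Matrix (Fin m) (Fin n) ℝ) : 0 ≤ frobSq A :=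
  Finset.sum_nonneg fun _ _ => Finset.sum_nonneg fun _ _ => sq_nonneg _

theorem frobSq_eq_sum_norm_sq (A : Matrix (Fin m) (Fin n) ℝ)
    (v : OrthonormalBasis (Fin n) ℝ (EuclideanSpace ℝ (Fin n))) :
    frobSq A = ∑ i, ‖Matrix.toEuclideanLin A (v i)‖ ^ 2 := by
  have h1 : ∀ x, ‖Matrix.toEuclideanLin A x‖ ^ 2 =
      ∑ r, inner ℝ x (WithLp.toLp 2 (A r)) ^ 2 := fun x => by
    rw [EuclideanSpace.norm_sq_eq]
    refine Finset.sum_congr rfl fun r _ => ?_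
    rw [Matrix.ofLp_toLpLin, Real.norm_eq_abs, sq_abs, PiLp.inner_apply]
    simp [Matrix.mulVec, dotProduct]
  simp only [h1]
  rw [Finset.sum_comm]
  refine Finset.sum_congr rfl fun r _ => ?_
  rw [v.sum_sq_inner_right, EuclideanSpace.norm_sq_eq]
  simp

theorem frobSq_eq_sum_singularValues_sq (A : Matrix (Fin m) (Fin n) ℝ) :
    frobSq A = ∑ i : Fin n, (Matrix.toEuclideanLin A).singularValues i ^ 2 := by
  obtain ⟨v, hv⟩ := exists_rightSingularBasis (Matrix.toEuclideanLin A)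
    (finrank_euclideanSpace_fin (𝕜 := ℝ) (n := n))
  rw [frobSq_eq_sum_norm_sq A v]
  refine Finset.sum_congr rfl fun i _ => ?_
  rw [← real_inner_self_eq_norm_sq, hv, if_pos rfl]

theorem singularValues_toEuclideanLin_of_le (A : Matrix (Fin m) (Fin n) ℝ) {i : ℕ} (hi : m ≤ i) :
    (Matrix.toEuclideanLin A).singularValues i = 0 := by
  rw [LinearMap.singularValues_eq_zero_iff_le_finrank_range]
  refine (Submodule.finrank_le _).trans ?_
  simpa using hi

/-- Subtracting P(0) kills the terms of index at least min(m, n), so the sum can run over all n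
right singular vectors. -/
theorem spectralPenalty_eq_sum (P : ℝ → ℝ) (A : Matrix (Fin m) (Fin n) ℝ) :
    spectralPenalty P A =
      ∑ i : Fin n, (P ((Matrix.toEuclideanLin A).singularValues i) - P 0) + min m n * P 0 := by
  have h1 : spectralPenalty P A =
      ∑ i ∈ Finset.range (min m n), P ((Matrix.toEuclideanLin A).singularValues i) := by
    rw [spectralPenalty, Finset.range_eq_Ico, ← Finset.Ico_add_one_right_eq_Icc,
      ← zero_add 1, ← Finset.sum_Ico_add']
    simp [sigma]
  have h2 : ∑ i : Fin n, (P ((Matrix.toEuclideanLin A).singularValues i) - P 0) =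
      ∑ i ∈ Finset.range (min m n), (P ((Matrix.toEuclideanLin A).singularValues i) - P 0) := by
    rw [Fin.sum_univ_eq_sum_range
      (fun i => P ((Matrix.toEuclideanLin A).singularValues i) - P 0) n]
    symm
    refine Finset.sum_subset (by simp) fun i hi hi' => ?_
    simp only [Finset.mem_range, lt_min_iff, not_and_or, not_lt] at hi hi'
    rw [singularValues_toEuclideanLin_of_le A (by omega), sub_self]
  rw [h1, h2, Finset.sum_sub_distrib]
  simp

/-- The squared Frobenius norm is ∑ σ_i², so up to a constant this is the spectral function of a
convex nondecreasing Q with Q(0) = 0. -/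
theorem spectralPenalty_add_frobSq_midpoint_le {P : ℝ → ℝ} {c : ℝ} (hc : 0 ≤ c)
    (hmono : MonotoneOn P (Set.Ici 0))
    (hconv : ConvexOn ℝ (Set.Ici 0) fun t => P t + c / 2 * t ^ 2)
    (A B : Matrix (Fin m) (Fin n) ℝ) :
    spectralPenalty P ((1 / 2 : ℝ) • (A + B)) + c / 2 * frobSq ((1 / 2 : ℝ) • (A + B)) ≤
      1 / 2 * (spectralPenalty P A + c / 2 * frobSq A) +
        1 / 2 * (spectralPenalty P B + c / 2 * frobSq B) := by
  set Q : ℝ → ℝ := fun t => P t + c / 2 * t ^ 2 - P 0 with hQ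
  have hsum : ∀ M : Matrix (Fin m) (Fin n) ℝ, spectralPenalty P M + c / 2 * frobSq M =
      ∑ i : Fin n, Q ((Matrix.toEuclideanLin M).singularValues i) + min m n * P 0 := fun M => by
    rw [spectralPenalty_eq_sum, frobSq_eq_sum_singularValues_sq, Finset.mul_sum, add_right_comm,
      ← Finset.sum_add_distrib]
    congr 1
    refine Finset.sum_congr rfl fun i _ => ?_
    simp only [hQ]
    ring
  have hQconv : ConvexOn ℝ (Set.Ici 0) Q := by
    have := hconv.add_const (-P 0)
    simpa only [hQ, sub_eq_add_neg, Pi.add_def] using this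
  have hQmono : MonotoneOn Q (Set.Ici 0) := fun x hx y hy hxy => by
    have h1 := hmono hx hy hxy
    have h2 : x ^ 2 ≤ y ^ 2 := pow_le_pow_left₀ hx hxy 2
    simp only [hQ]
    nlinarith
  have := sum_singularValues_midpoint_le (Matrix.toEuclideanLin A) (Matrix.toEuclideanLin B)
    (finrank_euclideanSpace_fin (𝕜 := ℝ) (n := n)) hQconv hQmono (by simp [hQ])
  rw [← map_add, ← map_smul] at this
  rw [hsum, hsum, hsum]
  linarith

theorem frobSq_midpoint (A B : Matrix (Fin m) (Fin n) ℝ) :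
    frobSq ((1 / 2 : ℝ) • (A + B)) =
      1 / 2 * frobSq A + 1 / 2 * frobSq B - 1 / 4 * frobSq (A - B) := by
  simp only [frobSq, Finset.mul_sum, ← Finset.sum_add_distrib, ← Finset.sum_sub_distrib]
  refine Finset.sum_congr rfl fun i _ => Finset.sum_congr rfl fun j _ => ?_
  simp
  ring

theorem frobSq_proj_add_frobSq_projPerp (Ω : Finset (Fin m × Fin n))
    (A B : Matrix (Fin m) (Fin n) ℝ) :
    frobSq (proj Ω A) + frobSq (projPerp Ω B) = frobSq (proj Ω A + projPerp Ω B) := by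
  simp only [frobSq, ← Finset.sum_add_distrib]
  refine Finset.sum_congr rfl fun i _ => Finset.sum_congr rfl fun j _ => ?_
  simp only [proj, projPerp, Matrix.add_apply, Matrix.sub_apply, Matrix.of_apply]
  split_ifs <;> simp

/-- The majorizer with `ℓ = 0` is a shifted squared distance plus the penalty. -/
theorem majorizer_zero_eq (Ω : Finset (Fin m × Fin n)) (Y : Matrix (Fin m) (Fin n) ℝ)
    (P : ℝ → ℝ) (W X : Matrix (Fin m) (Fin n) ℝ) :
    majorizer Ω Y P 0 W X =
      1 / 2 * frobSq (X - (proj Ω Y + projPerp Ω W)) + spectralPenalty P X := by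
  have : X - (proj Ω Y + projPerp Ω W) = proj Ω (X - Y) + projPerp Ω (X - W) := by
    ext i j
    simp only [proj, projPerp, Matrix.add_apply, Matrix.sub_apply, Matrix.of_apply]
    split_ifs <;> ring
  rw [this, ← frobSq_proj_add_frobSq_projPerp, majorizer]
  ring

/-- Strong midpoint convexity of the majorizer. -/
theorem majorizer_midpoint_le {P : ℝ → ℝ} {c : ℝ} (hc : 0 ≤ c)
    (hmono : MonotoneOn P (Set.Ici 0))
    (hconv : ConvexOn ℝ (Set.Ici 0) fun t => P t + c / 2 * t ^ 2)
    (Ω : Finset (Fin m × Fin n)) (Y W A B : Matrix (Fin m) (Fin n) ℝ) :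
    majorizer Ω Y P 0 W ((1 / 2 : ℝ) • (A + B)) + (1 - c) / 8 * frobSq (A - B) ≤
      1 / 2 * majorizer Ω Y P 0 W A + 1 / 2 * majorizer Ω Y P 0 W B := by
  have h1 := spectralPenalty_add_frobSq_midpoint_le hc hmono hconv A B
  have h2 := frobSq_midpoint A B
  have h3 := frobSq_midpoint (A - (proj Ω Y + projPerp Ω W)) (B - (proj Ω Y + projPerp Ω W))
  have h4 : (1 / 2 : ℝ) • (A - (proj Ω Y + projPerp Ω W) + (B - (proj Ω Y + projPerp Ω W))) =
      (1 / 2 : ℝ) • (A + B) - (proj Ω Y + projPerp Ω W) := by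
    module
  rw [h4, sub_sub_sub_cancel_right] at h3
  simp only [majorizer_zero_eq]
  rw [h2] at h1
  rw [h3]
  nlinarith

/-- The objective minimized by the iteration. -/
noncomputable def objective (Ω : Finset (Fin m × Fin n)) (Y : Matrix (Fin m) (Fin n) ℝ) (P : ℝ → ℝ)
    (X : Matrix (Fin m) (Fin n) ℝ) : ℝ :=
  1 / 2 * frobSq (proj Ω (X - Y)) + spectralPenalty P X

theorem majorizer_self (Ω : Finset (Fin m × Fin n)) (Y : Matrix (Fin m) (Fin n) ℝ)
    (P : ℝ → ℝ) (l : ℝ) (X : Matrix (Fin m) (Fin n) ℝ) :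
    majorizer Ω Y P l X X = objective Ω Y P X := by
  simp [majorizer, objective, frobSq, projPerp, proj]

theorem objective_add_le_majorizer (Ω : Finset (Fin m × Fin n)) (Y : Matrix (Fin m) (Fin n) ℝ)
    (P : ℝ → ℝ) (l : ℝ) (W X : Matrix (Fin m) (Fin n) ℝ) :
    objective Ω Y P X + l / 2 * frobSq (X - W) ≤ majorizer Ω Y P l W X := by
  rw [majorizer, objective]
  linarith [frobSq_nonneg (projPerp Ω (X - W))]

theorem bddBelow_range_objective (Ω : Finset (Fin m × Fin n)) (Y : Matrix (Fin m) (Fin n) ℝ)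
    {P : ℝ → ℝ} (hbdd : BddBelow (P '' Set.Ici 0)) :
    BddBelow (Set.range (objective Ω Y P)) := by
  obtain ⟨b, hb⟩ := hbdd
  refine ⟨∑ _i ∈ Finset.Icc 1 (min m n), b, ?_⟩
  rintro _ ⟨X, rfl⟩
  have h1 : ∑ _i ∈ Finset.Icc 1 (min m n), b ≤ spectralPenalty P X :=
    Finset.sum_le_sum fun i _ => hb ⟨_, LinearMap.singularValues_nonneg _ _, rfl⟩
  rw [objective]
  linarith [frobSq_nonneg (proj Ω (X - Y))]

/-- The objective decreases by at least a multiple of the squared step. -/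
theorem exists_sufficient_decrease (Ω : Finset (Fin m × Fin n)) (Y : Matrix (Fin m) (Fin n) ℝ)
    {P : ℝ → ℝ} (hconc : ConcaveOn ℝ (Set.Ici 0) P) (hdiff : DifferentiableOn ℝ P (Set.Ioi 0))
    (hbdd : BddBelow (P '' Set.Ici 0)) {l : ℝ} (hl : 0 ≤ l)
    (hcont : l = 0 → ContinuousWithinAt P (Set.Ici 0) 0)
    (hnu : 0 < nuDagger P l + (l : EReal)) :
    ∃ κ > 0, ∀ W X : Matrix (Fin m) (Fin n) ℝ, IsMinOn (majorizer Ω Y P l W) Set.univ X →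
      objective Ω Y P X + κ * frobSq (X - W) ≤ objective Ω Y P W := by
  rcases hl.eq_or_lt with rfl | hlpos
  · obtain ⟨c, hc0, hc1, hc⟩ := exists_lt_one_neg_le_phi hnu
    have hconv := convexOn_add_sq hdiff (hcont rfl) hc
    have hmono := monotoneOn_of_concaveOn_of_bddBelow hconc hbdd
    refine ⟨(1 - c) / 4, by linarith, fun W X hX => ?_⟩
    -- Minimality is tested at the midpoint of X and W; doubling the resulting inequality turns (1 -
    -- c)/8 into (1 - c)/4.
    have h1 := majorizer_midpoint_le hc0 hmono hconv Ω Y W X W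
    have h2 : majorizer Ω Y P 0 W X ≤ majorizer Ω Y P 0 W ((1 / 2 : ℝ) • (X + W)) :=
      hX (Set.mem_univ _)
    have h3 := objective_add_le_majorizer Ω Y P 0 W X
    rw [majorizer_self] at h1
    linarith
  · refine ⟨l / 2, by linarith, fun W X hX => ?_⟩
    have h2 : majorizer Ω Y P l W X ≤ majorizer Ω Y P l W W := hX (Set.mem_univ _)
    rw [majorizer_self] at h2
    exact (objective_add_le_majorizer Ω Y P l W X).trans h2

/-- f is nonincreasing and bounded below, hence convergent, and its consecutive differences dominate
κ g. -/
theorem tendsto_zero_of_add_mul_le {f g : ℕ → ℝ} {κ : ℝ} (hκ : 0 < κ) (hg : ∀ k, 0 ≤ g k)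
    (hf : BddBelow (Set.range f)) (h : ∀ k, f (k + 1) + κ * g k ≤ f k) :
    Tendsto g atTop (𝓝 0) := by
  have hanti : Antitone f := antitone_nat_of_succ_le fun k => by
    have := mul_nonneg hκ.le (hg k)
    linarith [h k]
  have hlim := tendsto_atTop_ciInf hanti hf
  have hdiff : Tendsto (fun k => (f k - f (k + 1)) / κ) atTop (𝓝 0) := by
    simpa using (hlim.sub (hlim.comp (tendsto_add_atTop_nat 1))).div_const κ
  refine squeeze_zero hg (fun k => ?_) hdiff
  rw [le_div_iff₀ hκ]
  linarith [h k]

theorem tendsto_frobSq_step (Ω : Finset (Fin m × Fin n)) (Y : Matrix (Fin m) (Fin n) ℝ)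
    {P : ℝ → ℝ} (hconc : ConcaveOn ℝ (Set.Ici 0) P) (hdiff : DifferentiableOn ℝ P (Set.Ioi 0))
    (hbdd : BddBelow (P '' Set.Ici 0)) {l : ℝ} (hl : 0 ≤ l)
    (hcont : l = 0 → ContinuousWithinAt P (Set.Ici 0) 0)
    (hnu : 0 < nuDagger P l + (l : EReal)) {X : ℕ → Matrix (Fin m) (Fin n) ℝ}
    (hX : ∀ k, IsMinOn (majorizer Ω Y P l (X k)) Set.univ (X (k + 1))) :
    Tendsto (fun k => frobSq (X (k + 1) - X k)) atTop (𝓝 0) := by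
  obtain ⟨κ, hκ, h⟩ := exists_sufficient_decrease Ω Y hconc hdiff hbdd hl hcont hnu
  refine tendsto_zero_of_add_mul_le (f := fun k => objective Ω Y P (X k)) hκ
    (fun k => frobSq_nonneg _) ?_ fun k => h _ _ (hX k)
  exact (bddBelow_range_objective Ω Y hbdd).mono
    (Set.range_comp_subset_range X (objective Ω Y P))

end Descent

/-! ### Residuals of orthogonal projection onto an orthonormal family -/

section Residual

variable {E : Type*} [NormedAddCommGroup E] [InnerProductSpace ℝ E]

theorem norm_sq_sum_smul_of_orthogonal {ι : Type*} [Fintype ι] [DecidableEq ι] {w : ι → E}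
    (hw : ∀ i j, i ≠ j → inner ℝ (w i) (w j) = 0) (c : ι → ℝ) :
    ‖∑ k, c k • w k‖ ^ 2 = ∑ k, c k ^ 2 * ‖w k‖ ^ 2 := by
  rw [← real_inner_self_eq_norm_sq]
  simp only [sum_inner, inner_sum, inner_smul_left, inner_smul_right]
  refine Finset.sum_congr rfl fun i _ => ?_
  rw [Finset.sum_eq_single i (fun j _ hj => by simp [hw j i hj]) (by simp),
    real_inner_self_eq_norm_sq]
  simp
  ring

/-- The component of `x` orthogonal to the family `v`. -/
noncomputable def residual {p : ℕ} (v : Fin p → E) (x : E) : E := x - ∑ j, inner ℝ (v j) x • v j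

theorem inner_residual {p : ℕ} {v : Fin p → E} (hv : Orthonormal ℝ v) (x : E) (j : Fin p) :
    inner ℝ (v j) (residual v x) = 0 := by
  rw [residual, inner_sub_right, hv.inner_right_fintype, sub_self]

theorem norm_residual_sq {p : ℕ} {v : Fin p → E} (hv : Orthonormal ℝ v) (x : E) :
    ‖residual v x‖ ^ 2 = ‖x‖ ^ 2 - ∑ j, inner ℝ (v j) x ^ 2 := by
  rw [residual, norm_sub_sq_real, norm_sq_sum_smul_of_orthogonal fun i k hik => hv.2 hik]
  simp only [hv.1, inner_sum, inner_smul_right, real_inner_comm]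
  simp
  ring_nf

theorem residual_add {p : ℕ} (v : Fin p → E) (x y : E) :
    residual v (x + y) = residual v x + residual v y := by
  simp only [residual, inner_add_right, add_smul, Finset.sum_add_distrib]
  abel

theorem residual_smul {p : ℕ} (v : Fin p → E) (c : ℝ) (x : E) :
    residual v (c • x) = c • residual v x := by
  simp only [residual, inner_smul_right, smul_sub, Finset.smul_sum, smul_smul]

theorem norm_residual_le {p : ℕ} {v : Fin p → E} (hv : Orthonormal ℝ v) (x : E) :
    ‖residual v x‖ ≤ ‖x‖ := by
  rw [← sq_le_sq₀ (norm_nonneg _) (norm_nonneg _), norm_residual_sq hv]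
  have : 0 ≤ ∑ j, inner ℝ (v j) x ^ 2 := Finset.sum_nonneg fun _ _ => sq_nonneg _
  linarith

end Residual

/-! ### Weyl's inequality and Wedin's bound -/

section Perturbation

variable {E F : Type*} [NormedAddCommGroup E] [InnerProductSpace ℝ E] [FiniteDimensional ℝ E]
  [NormedAddCommGroup F] [InnerProductSpace ℝ F] [FiniteDimensional ℝ F]

open Module

/-- The Courant-Fischer lower bound on the span of orthogonal vectors with orthogonal images. -/
theorem le_singularValues_of_orthogonal (T : E →ₗ[ℝ] F) {j : ℕ} {s : ℝ} (hs : 0 ≤ s)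
    {w : Fin (j + 1) → E} (hw0 : ∀ k, w k ≠ 0) (hw : ∀ i k, i ≠ k → inner ℝ (w i) (w k) = 0)
    (hTw : ∀ i k, i ≠ k → inner ℝ (T (w i)) (T (w k)) = 0)
    (h : ∀ k, s * ‖w k‖ ≤ ‖T (w k)‖) : s ≤ T.singularValues j := by
  refine le_singularValues_of_le_norm_map T
    (linearIndependent_of_ne_zero_of_inner_eq_zero hw0 fun i k hik => hw i k hik) fun c => ?_
  rw [← sq_le_sq₀ (by positivity) (norm_nonneg _), mul_pow, map_sum]
  simp only [map_smul]
  rw [norm_sq_sum_smul_of_orthogonal hw, norm_sq_sum_smul_of_orthogonal hTw, Finset.mul_sum]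
  refine Finset.sum_le_sum fun k _ => ?_
  have := pow_le_pow_left₀ (by positivity) (h k) 2
  nlinarith [sq_nonneg (c k)]

/-- Weyl's perturbation inequality. -/
theorem singularValues_le_add (S T : E →ₗ[ℝ] F) {e : ℝ} (he : 0 ≤ e)
    (h : ∀ x, ‖(S - T) x‖ ≤ e * ‖x‖) (j : ℕ) :
    T.singularValues j ≤ S.singularValues j + e := by
  by_cases hj : finrank ℝ E ≤ j
  · rw [T.singularValues_of_finrank_le hj]
    exact add_nonneg (S.singularValues_nonneg j) he
  obtain ⟨v, hv⟩ := exists_rightSingularBasis T rfl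
  -- On the span of the first j + 1 right singular vectors of T, T stretches by at least its
  -- singular value of index j, and S by at least that minus e.
  let w : Fin (j + 1) → E := fun k => v ⟨k, by omega⟩
  have hinj : Function.Injective fun k : Fin (j + 1) => (⟨k, by omega⟩ : Fin (finrank ℝ E)) :=
    fun a b hab => by simpa [Fin.ext_iff] using hab
  have hwo : Orthonormal ℝ w := v.orthonormal.comp _ hinj
  rw [← sub_le_iff_le_add]
  refine le_singularValues_of_le_norm_map S hwo.linearIndependent fun c => ?_
  set x := ∑ k, c k • w k with hx
  have hT : T.singularValues j * ‖x‖ ≤ ‖T x‖ := by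
    rw [← sq_le_sq₀ (mul_nonneg (T.singularValues_nonneg j) (norm_nonneg _)) (norm_nonneg _),
      mul_pow, hx, map_sum]
    simp only [map_smul]
    rw [norm_sq_sum_smul_of_orthogonal (fun i k hik => hwo.2 hik),
      norm_sq_sum_smul_of_orthogonal (fun i k hik => ?_), Finset.mul_sum]
    · refine Finset.sum_le_sum fun k _ => ?_
      have h1 : ‖T (w k)‖ ^ 2 = T.singularValues k ^ 2 := by
        rw [← real_inner_self_eq_norm_sq, hv, if_pos rfl]
      have h2 : T.singularValues j ≤ T.singularValues k :=
        T.singularValues_antitone (Nat.lt_succ_iff.1 k.2)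
      rw [h1, hwo.1 k]
      have := pow_le_pow_left₀ (T.singularValues_nonneg j) h2 2
      nlinarith [sq_nonneg (c k)]
    · rw [hv, if_neg (hinj.ne hik)]
  have h3 : ‖T x‖ ≤ ‖S x‖ + e * ‖x‖ := by
    have := norm_sub_le (S x) ((S - T) x)
    rw [LinearMap.sub_apply, sub_sub_cancel] at this
    have h4 := h x
    rw [LinearMap.sub_apply] at h4
    linarith
  linarith

/-- ‖T*y‖² = ⟨T T*y, y⟩. Asking for the bound only at T*y lets bounds valid on a subspace pass to
the adjoint. -/
theorem norm_adjoint_apply_le (T : E →ₗ[ℝ] F) {c : ℝ} (hc : 0 ≤ c) {y : F}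
    (h : ‖T (T.adjoint y)‖ ≤ c * ‖T.adjoint y‖) : ‖T.adjoint y‖ ≤ c * ‖y‖ := by
  rcases eq_or_ne (T.adjoint y) 0 with h0 | h0
  · rw [h0, norm_zero]
    positivity
  · have h1 : ‖T.adjoint y‖ ^ 2 ≤ ‖T (T.adjoint y)‖ * ‖y‖ := by
      rw [← real_inner_self_eq_norm_sq, LinearMap.adjoint_inner_right]
      exact real_inner_le_norm _ _
    have h2 : 0 < ‖T.adjoint y‖ := norm_pos_iff.2 h0
    have h3 := mul_le_mul_of_nonneg_right h (norm_nonneg y)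
    refine le_of_mul_le_mul_right ?_ h2
    nlinarith

/-- On the orthogonal complement of top right singular vectors, `T` is bounded by the next
singular value. -/
theorem norm_map_le_of_orthogonal_singularVectors (T : E →ₗ[ℝ] F) {p : ℕ} {v : Fin p → E}
    {u : Fin p → F} (hv : Orthonormal ℝ v) (hu : Orthonormal ℝ u)
    (hT : ∀ j, T (v j) = T.singularValues j • u j)
    (hT' : ∀ j, T.adjoint (u j) = T.singularValues j • v j) {x : E}
    (hx : ∀ j, inner ℝ (v j) x = 0) : ‖T x‖ ≤ T.singularValues p * ‖x‖ := by
  rcases eq_or_ne x 0 with rfl | hx0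
  · simp
  have hxpos : 0 < ‖x‖ := norm_pos_iff.2 hx0
  by_contra! hlt
  set s := ‖T x‖ / ‖x‖ with hs
  have hs0 : 0 ≤ s := by positivity
  have hsx : s * ‖x‖ = ‖T x‖ := div_mul_cancel₀ _ hxpos.ne'
  have hex : ∃ j, T.singularValues j < s := ⟨p, (lt_div_iff₀ hxpos).2 hlt⟩
  classical
  -- Taking the first index whose singular value is below s ensures that v_0, …, v_{j-1} are all
  -- stretched by at least s. Adding x gives j + 1 such vectors, contradicting Courant-Fischer;
  -- index p itself need not work.
  set j := Nat.find hex with hj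
  have hjp : j ≤ p := Nat.find_min' hex ((lt_div_iff₀ hxpos).2 hlt)
  have hjs : T.singularValues j < s := Nat.find_spec hex
  have hmin : ∀ i < j, s ≤ T.singularValues i := fun i hi => not_lt.1 (Nat.find_min hex hi)
  let w : Fin (j + 1) → E := fun k => if h : k.1 < j then v ⟨k, h.trans_le hjp⟩ else x
  have hTx : ∀ i, inner ℝ (T (v i)) (T x) = 0 := fun i => by
    rw [← LinearMap.adjoint_inner_left, hT, map_smul, hT', smul_smul, inner_smul_left, hx]
    simp
  have hlast : ∀ k : Fin (j + 1), ¬ k.1 < j → k.1 = j := fun k hk => by omega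
  refine absurd (le_singularValues_of_orthogonal T hs0 (w := w) (fun k => ?_) (fun i k hik => ?_)
    (fun i k hik => ?_) fun k => ?_) (not_le.2 hjs)
  · simp only [w]
    split_ifs
    · exact hv.ne_zero _
    · exact hx0
  · have hik' : i.1 ≠ k.1 := fun h => hik (Fin.ext h)
    simp only [w]
    split_ifs with h1 h2 h2
    · exact hv.2 (by simpa [Fin.ext_iff] using hik')
    · exact hx _
    · rw [real_inner_comm]; exact hx _
    · exact absurd ((hlast i h1).trans (hlast k h2).symm) hik'
  · have hik' : i.1 ≠ k.1 := fun h => hik (Fin.ext h)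
    simp only [w]
    split_ifs with h1 h2 h2
    · rw [hT, hT, inner_smul_left, inner_smul_right, hu.2 (by simpa [Fin.ext_iff] using hik')]
      simp
    · exact hTx _
    · rw [real_inner_comm]; exact hTx _
    · exact absurd ((hlast i h1).trans (hlast k h2).symm) hik'
  · simp only [w]
    split_ifs with h1
    · rw [hT, norm_smul, hv.1, hu.1, Real.norm_of_nonneg (T.singularValues_nonneg _)]
      simpa using hmin k h1
    · exact hsx.le

/-- Paired singular vectors make T intertwine the two projections. -/
theorem residual_map (T : E →ₗ[ℝ] F) {p : ℕ} {v : Fin p → E} {u : Fin p → F} {σ : Fin p → ℝ}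
    (hT : ∀ j, T (v j) = σ j • u j) (hT' : ∀ j, T.adjoint (u j) = σ j • v j) (x : E) :
    residual u (T x) = T (residual v x) := by
  simp only [residual, map_sub, map_sum, map_smul, hT, ← LinearMap.adjoint_inner_left, hT',
    inner_smul_left, smul_smul]
  simp [mul_comm]

/-- Half of Wedin's coupled inequalities. -/
theorem mul_norm_residual_le (S T : E →ₗ[ℝ] F) {p : ℕ} {v : Fin p → E} {u : Fin p → F}
    {σ : Fin p → ℝ} {s e τ : ℝ} (hv : Orthonormal ℝ v) (hu : Orthonormal ℝ u)
    (hT : ∀ j, T (v j) = σ j • u j) (hT' : ∀ j, T.adjoint (u j) = σ j • v j)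
    (hs : ∀ x, (∀ j, inner ℝ (v j) x = 0) → ‖T x‖ ≤ s * ‖x‖)
    (he : ∀ x, ‖(S - T) x‖ ≤ e * ‖x‖) {x : E} {y : F} (hx : ‖x‖ = 1) (hτ : 0 ≤ τ)
    (hxy : S x = τ • y) : τ * ‖residual u y‖ ≤ e + s * ‖residual v x‖ := by
  have h1 : τ • residual u y = residual u ((S - T) x) + T (residual v x) := by
    rw [← residual_smul, ← hxy, ← residual_map T hT hT', ← residual_add, LinearMap.sub_apply,
      sub_add_cancel]
  calc τ * ‖residual u y‖ = ‖τ • residual u y‖ := by rw [norm_smul, Real.norm_of_nonneg hτ]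
    _ ≤ ‖residual u ((S - T) x)‖ + ‖T (residual v x)‖ := by
      rw [h1]
      exact norm_add_le _ _
    _ ≤ e + s * ‖residual v x‖ := by
      refine add_le_add ((norm_residual_le hu _).trans ?_) (hs _ (inner_residual hv x))
      simpa [hx] using he x

/-- Wedin's bound for a single pair of singular vectors of the perturbed map. -/
theorem norm_residual_le_div (S T : E →ₗ[ℝ] F) {p : ℕ} {v : Fin p → E} {u : Fin p → F}
    {e τ g : ℝ} (hv : Orthonormal ℝ v) (hu : Orthonormal ℝ u)
    (hT : ∀ j, T (v j) = T.singularValues j • u j)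
    (hT' : ∀ j, T.adjoint (u j) = T.singularValues j • v j)
    (he0 : 0 ≤ e) (he : ∀ x, ‖(S - T) x‖ ≤ e * ‖x‖) {x : E} {y : F} (hx : ‖x‖ = 1) (hy : ‖y‖ = 1)
    (hxy : S x = τ • y) (hyx : S.adjoint y = τ • x) (hg : 0 < g)
    (hgap : T.singularValues p + g ≤ τ) :
    ‖residual u y‖ ≤ e / g ∧ ‖residual v x‖ ≤ e / g := by
  have hs0 := T.singularValues_nonneg p
  have hτ : 0 ≤ τ := by linarith
  have hs := fun x hx => norm_map_le_of_orthogonal_singularVectors T hv hu hT hT' (x := x) hx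
  have hs' : ∀ y, (∀ j, inner ℝ (u j) y = 0) → ‖T.adjoint y‖ ≤ T.singularValues p * ‖y‖ :=
    fun y hy => norm_adjoint_apply_le T hs0 <| hs _ fun j => by
      rw [LinearMap.adjoint_inner_right, hT, inner_smul_left, hy, mul_zero]
  have he' : ∀ y, ‖(S.adjoint - T.adjoint) y‖ ≤ e * ‖y‖ := fun y => by
    rw [← map_sub]
    exact norm_adjoint_apply_le _ he0 (he _)
  have h1 := mul_norm_residual_le S T hv hu hT hT' hs he hx hτ hxy
  have h2 := mul_norm_residual_le S.adjoint T.adjoint hu hv hT'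
    (by simpa only [LinearMap.adjoint_adjoint] using hT) hs' he' hy hτ hyx
  have hb := norm_nonneg (residual v x)
  have ha := norm_nonneg (residual u y)
  rw [le_div_iff₀ hg, le_div_iff₀ hg]
  -- If r is the larger residual, the coupled inequalities give τ r ≤ e + σ r with τ - σ ≥ g, so r g
  -- ≤ e.
  rcases le_total ‖residual u y‖ ‖residual v x‖ with h | h
  · have : ‖residual v x‖ * g ≤ e := by nlinarith
    exact ⟨by nlinarith, this⟩
  · have : ‖residual u y‖ * g ≤ e := by nlinarith
    exact ⟨this, by nlinarith⟩

end Perturbation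

/-! ### From singular frames of matrices to canonical angles -/

section Frames

variable {m n : ℕ}

theorem norm_toEuclideanLin_apply_le (A : Matrix (Fin m) (Fin n) ℝ) (x) :
    ‖Matrix.toEuclideanLin A x‖ ≤ √(frobSq A) * ‖x‖ := by
  obtain ⟨v, hv⟩ := exists_rightSingularBasis (Matrix.toEuclideanLin A)
    (finrank_euclideanSpace_fin (𝕜 := ℝ) (n := n))
  rw [← sq_le_sq₀ (norm_nonneg _) (by positivity), mul_pow, Real.sq_sqrt (frobSq_nonneg A),
    norm_map_sq_of_rightSingularBasis _ v hv, frobSq_eq_sum_singularValues_sq, Finset.sum_mul]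
  refine Finset.sum_le_sum fun i _ => mul_le_mul_of_nonneg_left ?_ (sq_nonneg _)
  rw [← v.sum_sq_inner_right x]
  exact Finset.single_le_sum (f := fun i => inner ℝ (v i) x ^ 2) (fun _ _ => sq_nonneg _)
    (Finset.mem_univ i)

theorem abs_sin_arcsin_le {t : ℝ} (ht : 0 ≤ t) : |Real.sin (Real.arcsin t)| ≤ t := by
  rcases le_total t 1 with h | h
  · rw [Real.sin_arcsin (by linarith) h, abs_of_nonneg ht]
  · exact (Real.abs_sin_le_one _).trans h

theorem spectralNorm_diagonal_le {p : ℕ} {d : Fin p → ℝ} {c : ℝ} (hc : 0 ≤ c)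
    (hd : ∀ i, |d i| ≤ c) : spectralNorm (Matrix.diagonal d) ≤ c := by
  refine ContinuousLinearMap.opNorm_le_bound _ hc fun x => ?_
  rw [← sq_le_sq₀ (norm_nonneg _) (by positivity), mul_pow, EuclideanSpace.norm_sq_eq,
    EuclideanSpace.norm_sq_eq, Finset.mul_sum]
  refine Finset.sum_le_sum fun i _ => ?_
  rw [Matrix.ofLp_toEuclideanCLM, Matrix.mulVec_diagonal, norm_mul, mul_pow]
  exact mul_le_mul_of_nonneg_right (pow_le_pow_left₀ (norm_nonneg _) (hd i) 2) (sq_nonneg _)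

theorem sinThetaNorm_nonneg {p q : ℕ} (T : Matrix (Fin m) (Fin q) ℝ)
    (S : Matrix (Fin m) (Fin p) ℝ) : 0 ≤ sinThetaNorm T S :=
  norm_nonneg _

theorem sinThetaNorm_le_sqrt_frobSq {p q : ℕ} (T : Matrix (Fin m) (Fin q) ℝ)
    (S : Matrix (Fin m) (Fin p) ℝ) : sinThetaNorm T S ≤ √(frobSq (T.transpose * S)) := by
  refine spectralNorm_diagonal_le (Real.sqrt_nonneg _) fun i => ?_
  refine (abs_sin_arcsin_le (LinearMap.singularValues_nonneg _ _)).trans ?_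
  exact singularValues_le_of_norm_map_le _ (Real.sqrt_nonneg _) (norm_toEuclideanLin_apply_le _) _

/-- The `j`-th column of a matrix as a Euclidean vector. -/
noncomputable def column {p : ℕ} (S : Matrix (Fin m) (Fin p) ℝ) (j : Fin p) :
    EuclideanSpace ℝ (Fin m) :=
  WithLp.toLp 2 (S.col j)

theorem IsOrthonormalCompletion.orthonormal {p : ℕ} {S : Matrix (Fin m) (Fin p) ℝ}
    {T : Matrix (Fin m) (Fin (m - p)) ℝ} (h : IsOrthonormalCompletion S T) :
    Orthonormal ℝ (column S) := by
  rw [orthonormal_iff_ite]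
  intro i j
  have := congrFun (congrFun h.1 (Sum.inl i)) (Sum.inl j)
  rw [Matrix.mul_apply] at this
  simp only [Matrix.transpose_apply, Matrix.fromCols_apply_inl, Matrix.one_apply,
    Sum.inl.injEq] at this
  rw [← this]
  simp [column, PiLp.inner_apply, mul_comm]

/-- Parseval for the orthogonal matrix [S, T]: the coordinates along T carry exactly what projection
onto S misses. -/
theorem IsOrthonormalCompletion.sum_sq_eq_norm_residual_sq {p : ℕ} {S : Matrix (Fin m) (Fin p) ℝ}
    {T : Matrix (Fin m) (Fin (m - p)) ℝ} (h : IsOrthonormalCompletion S T)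
    (x : EuclideanSpace ℝ (Fin m)) :
    ∑ r, (T.transpose.mulVec x.ofLp r) ^ 2 = ‖residual (column S) x‖ ^ 2 := by
  rw [norm_residual_sq h.orthonormal, eq_sub_iff_add_eq]
  have h1 : ∀ W : Matrix (Fin m) (Fin p ⊕ Fin (m - p)) ℝ, W * W.transpose = 1 →
      ∑ r, (W.transpose.mulVec x.ofLp r) ^ 2 = ‖x‖ ^ 2 := fun W hW => by
    have : W.transpose.mulVec x.ofLp ⬝ᵥ W.transpose.mulVec x.ofLp = x.ofLp ⬝ᵥ x.ofLp := by
      rw [Matrix.dotProduct_mulVec, Matrix.vecMul_transpose, Matrix.mulVec_mulVec, hW,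
        Matrix.one_mulVec]
    rw [EuclideanSpace.norm_sq_eq]
    simpa [dotProduct, sq] using this
  have h2 := h1 _ h.2
  rw [Fintype.sum_sum_type] at h2
  rw [← h2, add_comm]
  congr 1
  refine Finset.sum_congr rfl fun i _ => ?_
  simp [column, PiLp.inner_apply, Matrix.mulVec, dotProduct, mul_comm]

theorem IsOrthonormalCompletion.frobSq_transpose_mul {p q : ℕ} {S : Matrix (Fin m) (Fin p) ℝ}
    {T : Matrix (Fin m) (Fin (m - p)) ℝ} (h : IsOrthonormalCompletion S T)
    (R : Matrix (Fin m) (Fin q) ℝ) :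
    frobSq (T.transpose * R) = ∑ j, ‖residual (column S) (column R j)‖ ^ 2 := by
  simp only [← h.sum_sq_eq_norm_residual_sq]
  rw [frobSq, Finset.sum_comm]
  rfl

theorem toEuclideanLin_column {p : ℕ} {A : Matrix (Fin m) (Fin n) ℝ} {V : Matrix (Fin n) (Fin p) ℝ}
    {U : Matrix (Fin m) (Fin p) ℝ} {σ : Fin p → ℝ} (h : A * V = U * Matrix.diagonal σ)
    (j : Fin p) : Matrix.toEuclideanLin A (column V j) = σ j • column U j := by
  ext i
  have := congrFun (congrFun h i) j
  rw [Matrix.mul_diagonal] at this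
  simp only [column, Matrix.ofLp_toLpLin, Matrix.toLin'_apply, PiLp.smul_apply, smul_eq_mul,
    Matrix.col_apply]
  rw [mul_comm, ← this]
  rfl

theorem TopSingularFrame.map_column {p : ℕ} {A : Matrix (Fin m) (Fin n) ℝ}
    (a : TopSingularFrame p A) (j : Fin p) : Matrix.toEuclideanLin A (column a.V j) =
      (Matrix.toEuclideanLin A).singularValues j • column a.U j :=
  toEuclideanLin_column a.mul_V j

theorem TopSingularFrame.adjoint_column {p : ℕ} {A : Matrix (Fin m) (Fin n) ℝ}
    (a : TopSingularFrame p A) (j : Fin p) :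
    (Matrix.toEuclideanLin A).adjoint (column a.U j) =
      (Matrix.toEuclideanLin A).singularValues j • column a.V j := by
  rw [← Matrix.toEuclideanLin_conjTranspose_eq_adjoint, Matrix.conjTranspose_eq_transpose_of_trivial]
  exact toEuclideanLin_column a.transpose_mul_U j

theorem IsOrthonormalCompletion.sinThetaNorm_le {p : ℕ} {S : Matrix (Fin m) (Fin p) ℝ}
    {T : Matrix (Fin m) (Fin (m - p)) ℝ} (h : IsOrthonormalCompletion S T)
    {R : Matrix (Fin m) (Fin p) ℝ} {c : ℝ} (hc : 0 ≤ c)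
    (hR : ∀ j, ‖residual (column S) (column R j)‖ ≤ c) : sinThetaNorm T R ≤ √p * c := by
  refine (sinThetaNorm_le_sqrt_frobSq T R).trans (Real.sqrt_le_iff.2 ⟨by positivity, ?_⟩)
  rw [h.frobSq_transpose_mul, mul_pow, Real.sq_sqrt (Nat.cast_nonneg p)]
  refine (Finset.sum_le_sum fun j _ => pow_le_pow_left₀ (norm_nonneg _) (hR j) 2).trans_eq ?_
  simp

/-- A Wedin-type bound for the distance between top singular subspaces. -/
theorem rho_le {p : ℕ} (hp : 1 ≤ p) {A B : Matrix (Fin m) (Fin n) ℝ} (a : TopSingularFrame p A)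
    (b : TopSingularFrame p B) {g : ℝ} (hg : 0 < g) (hgap : sigma (p + 1) A + g ≤ sigma p B) :
    rho a b ≤ √p * (√(frobSq (B - A)) / g) := by
  have he : ∀ x, ‖(Matrix.toEuclideanLin B - Matrix.toEuclideanLin A) x‖ ≤
      √(frobSq (B - A)) * ‖x‖ := fun x => by
    rw [← map_sub]
    exact norm_toEuclideanLin_apply_le _ x
  have key := fun j => norm_residual_le_div (Matrix.toEuclideanLin B) (Matrix.toEuclideanLin A)
    a.orthV.orthonormal a.orthU.orthonormal a.map_column a.adjoint_column (Real.sqrt_nonneg _) he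
    (b.orthV.orthonormal.1 j) (b.orthU.orthonormal.1 j) (b.map_column j) (b.adjoint_column j) hg
    -- `sigma p B` is the singular value of zero-based index p - 1, the smallest among the indices j
    -- < p.
    (hgap.trans ((Matrix.toEuclideanLin B).singularValues_antitone (by omega)))
  have hc : 0 ≤ √(frobSq (B - A)) / g := by positivity
  exact max_le (a.orthU.sinThetaNorm_le hc fun j => (key j).1)
    (a.orthV.sinThetaNorm_le hc fun j => (key j).2)

theorem sigma_le_sigma_add (i : ℕ) (A B : Matrix (Fin m) (Fin n) ℝ) :
    sigma i A ≤ sigma i B + √(frobSq (B - A)) :=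
  singularValues_le_add _ _ (Real.sqrt_nonneg _) (fun x => by
    rw [← map_sub]
    exact norm_toEuclideanLin_apply_le _ x) _

theorem sigma_succ_le (i : ℕ) (A : Matrix (Fin m) (Fin n) ℝ) : sigma (i + 1) A ≤ sigma i A :=
  LinearMap.singularValues_antitone _ (by omega)

end Frames

end NCImpute

/-! ### The proposition -/

theorem mainTheorem8
    (m n : ℕ) (Ω : Finset (Fin m × Fin n)) (Y : Matrix (Fin m) (Fin n) ℝ)
    (P : ℝ → ℝ)
    (hconc : ConcaveOn ℝ (Set.Ici 0) P)
    (hdiff : DifferentiableOn ℝ P (Set.Ioi 0))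
    (hbdd : BddBelow (P '' Set.Ici 0))
    (l : ℝ) (hl : 0 ≤ l)
    (hcont : l = 0 → ContinuousWithinAt P (Set.Ici 0) 0)
    (X : ℕ → Matrix (Fin m) (Fin n) ℝ)
    (hX : ∀ k, IsMinOn (NCImpute.majorizer Ω Y P l (X k)) Set.univ (X (k + 1)))
    (hnu : 0 < NCImpute.nuDagger P l + (l : EReal))
    (p : ℕ) (hp1 : 1 ≤ p) (hp : p ≤ min m n)
    (hgap : 0 < liminf (fun k => ((|NCImpute.delta X p k| : ℝ) : EReal)) atTop)
    (a : ∀ k, NCImpute.TopSingularFrame p (X k))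
    (b : ∀ k, NCImpute.TopSingularFrame p (X (k + 1))) :
    Tendsto (fun k => NCImpute.rho (a k) (b k)) atTop (𝓝 0) := by
  have hstep : Tendsto (fun k => √(NCImpute.frobSq (X (k + 1) - X k))) atTop (𝓝 0) := by
    simpa using (NCImpute.tendsto_frobSq_step Ω Y hconc hdiff hbdd hl hcont hnu hX).sqrt
  obtain ⟨g, hg0, hg⟩ := EReal.lt_iff_exists_real_btwn.1 hgap
  replace hg0 : 0 < g := EReal.coe_pos.1 hg0
  have hev : ∀ᶠ k in atTop, g < |NCImpute.delta X p k| :=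
    (eventually_lt_of_lt_liminf hg).mono fun k hk => EReal.coe_lt_coe_iff.1 hk
  have hbound : Tendsto (fun k => √p * (√(NCImpute.frobSq (X (k + 1) - X k)) / g)) atTop (𝓝 0) := by
    simpa using (hstep.div_const g).const_mul √p
  refine squeeze_zero' (.of_forall fun k => le_max_of_le_left (NCImpute.sinThetaNorm_nonneg _ _))
    ?_ hbound
  filter_upwards [hev, hstep.eventually_lt_const hg0] with k hk hsk
  refine NCImpute.rho_le hp1 (a k) (b k) hg0 ?_
  have h1 := NCImpute.sigma_le_sigma_add p (X k) (X (k + 1))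
  have h2 := NCImpute.sigma_succ_le p (X k)
  rw [NCImpute.delta] at hk
  -- The case δ > g contradicts σ_{p+1}(X_k) ≤ σ_p(X_k) ≤ σ_p(X_{k+1}) + step, since the step is
  -- below g; the case -δ > g is the required gap.
  rcases lt_abs.1 hk with h | h <;> linarith
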